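/- Let $\mathbb D$ be the open unit disc of $\mathbb C$, $\overline{\mathbb D}$ its closure, and let $\tau_p$ be the topology of pointwise convergence on the space $C(\overline{\mathbb D})$ of continuous functions $\overline{\mathbb D}\to\mathbb C$. A linear operator $T$ on a space $E\subseteq C(\overline{\mathbb D})$ is called $\tau_p$-supercyclic if there is $f\in E$ such that $\{\lambda T^nf:\lambda\in\mathbb C,\ n=0,1,2,\dots\}$ is dense in $E$ for the topology induced by $\tau_p$. Let $A(\mathbb D)$ be the disc algebra, i.e. the space of all $f\in C(\overline{\mathbb D})$ that are analytic in $\mathbb D$; for $0<\alpha\le 1$ let $\mathrm{Lip}_\alpha(\mathbb D)$ be the space of all $f\in A(\mathbb D)$ for which there is a constant $K$ with $|f(z)-f(v)|\le K|z-v|^\alpha$ for all $z,v\in\overline{\mathbb D}$. (1) Let $E$ be a complex locally convex space continuously included in $(C(\overline{\mathbb D}),\tau_p)$ such that the evaluation functionals $\delta_z:f\mapsto f(z)$, $z\in\overline{\mathbb D}$, are linearly independent in the dual $E'$. Let $w\in C(\overline{\mathbb D})$ and let $\varphi\in A(\mathbb D)$ satisfy $\varphi(\overline{\mathbb D})\subseteq\overline{\mathbb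 D}$. If the weighted composition operator $C_{w,\varphi}:E\to E$, $f\mapsto w\cdot(f\circ\varphi)$, is well defined (i.e. $w\cdot(f\circ\varphi)\in E$ for all $f\in E$), then it is not $\tau_p$-supercyclic. (2) Let $E=A(\mathbb D)$, or $E=\mathrm{Lip}_\alpha(\mathbb D)$ with $0<\alpha\le1$. For all continuous $w:\overline{\mathbb D}\to\mathbb C$ and $\varphi:\overline{\mathbb D}\to\overline{\mathbb D}$ such that $C_{w,\varphi}$ maps $E$ into $E$, the operator $C_{w,\varphi}:E\to E$ is not $\tau_p$-supercyclic. -/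

import Mathlib

open Topology

universe u

/-- The closed unit disc of the complex plane, as a topological space. -/
abbrev ClosedDisc : Type := Metric.closedBall (0 : ℂ) 1

/-- The topology of pointwise convergence on the space of continuous functions on `X`. -/
noncomputable abbrev pointwiseTopology (X : Type*) [TopologicalSpace X] : TopologicalSpace C(X, ℂ) :=
  TopologicalSpace.induced (fun f : C(X, ℂ) => (f : X → ℂ)) inferInstance

/-- A continuous inclusion of the topological vector space `E` into `C(X)` with the topology of
pointwise convergence: an injective linear map which is continuous for that topology. -/
structure PointwiseEmbedding (X : Type*) [TopologicalSpace X] (E : Type*) [AddCommGroup E]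
    [Module ℂ E] [TopologicalSpace E] where
  toLin : E →ₗ[ℂ] C(X, ℂ)
  injective : Function.Injective toLin
  continuous : Continuous[inferInstance, pointwiseTopology X] toLin

/-- The evaluation functional `f ↦ f(x)`, as an element of the topological dual of `E`. -/
noncomputable def PointwiseEmbedding.eval {X : Type*} [TopologicalSpace X] {E : Type*} [AddCommGroup E]
    [Module ℂ E] [TopologicalSpace E] (J : PointwiseEmbedding X E) (x : X) : E →L[ℂ] ℂ where
  toFun f := J.toLin f x
  map_add' f g := by simp
  map_smul' c f := by simp
  cont := (continuous_apply x).comp (continuous_induced_rng.mp J.continuous)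

/-- An operator `T` is supercyclic for a topology `τ` if, for some vector `f`, the set of all
scalar multiples of the iterates `f, T f, T² f, …` is `τ`-dense. -/
noncomputable def IsSupercyclic {F : Type*} [AddCommGroup F] [Module ℂ F] (τ : TopologicalSpace F)
    (T : F →ₗ[ℂ] F) : Prop :=
  ∃ f : F, @Dense F τ {g : F | ∃ (c : ℂ) (n : ℕ), g = c • (T ^ n) f}

/-- Supercyclicity for the topology of pointwise convergence, on a space `E` whose elements are
regarded as continuous functions on `X` through the linear map `i`. -/
noncomputable def IsPointwiseSupercyclic {X : Type*} [TopologicalSpace X] {E : Type*} [AddCommGroup E]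
    [Module ℂ E] (i : E →ₗ[ℂ] C(X, ℂ)) (T : E →ₗ[ℂ] E) : Prop :=
  IsSupercyclic (TopologicalSpace.induced i (pointwiseTopology X)) T

/-- The weighted composition `f ↦ w · (f ∘ φ)` on `C(X)`. -/
noncomputable def weightedComp {X : Type*} [TopologicalSpace X] (w : C(X, ℂ)) (φ : C(X, X)) :
    C(X, ℂ) →ₗ[ℂ] C(X, ℂ) where
  toFun f := w * f.comp φ
  map_add' f g := by ext x; simp [mul_add]
  map_smul' c f := by ext x; simp [mul_left_comm]

/-- A function on the closed disc is analytic in the open disc. -/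
noncomputable def AnalyticInDisc (f : ClosedDisc → ℂ) : Prop :=
  ∃ g : ℂ → ℂ, DifferentiableOn ℂ g (Metric.ball 0 1) ∧
    ∀ z : ClosedDisc, (z : ℂ) ∈ Metric.ball (0 : ℂ) 1 → f z = g z

theorem AnalyticInDisc.zero : AnalyticInDisc (fun _ => 0) :=
  ⟨fun _ => 0, differentiableOn_const 0, fun _ _ => rfl⟩

theorem AnalyticInDisc.add {f₁ f₂ : ClosedDisc → ℂ} (h₁ : AnalyticInDisc f₁)
    (h₂ : AnalyticInDisc f₂) : AnalyticInDisc (fun z => f₁ z + f₂ z) := by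
  obtain ⟨g₁, hg₁, e₁⟩ := h₁
  obtain ⟨g₂, hg₂, e₂⟩ := h₂
  exact ⟨fun z => g₁ z + g₂ z, hg₁.add hg₂, fun z hz => by simp only [e₁ z hz, e₂ z hz]⟩

theorem AnalyticInDisc.const_mul {f : ClosedDisc → ℂ} (c : ℂ) (h : AnalyticInDisc f) :
    AnalyticInDisc (fun z => c * f z) := by
  obtain ⟨g, hg, e⟩ := h
  exact ⟨fun z => c * g z, hg.const_mul c, fun z hz => by simp only [e z hz]⟩

/-- The disc algebra: continuous functions on the closed disc, analytic in the open disc. -/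
noncomputable def discAlgebra : Submodule ℂ C(ClosedDisc, ℂ) where
  carrier := {f | AnalyticInDisc f}
  zero_mem' := AnalyticInDisc.zero
  add_mem' h₁ h₂ := h₁.add h₂
  smul_mem' c _ h := h.const_mul c

/-- The analytic Lipschitz space of order `α`: functions on the closed disc, analytic in the open
disc, with `|f(z) - f(v)| = O(|z - v| ^ α)` for all `z, v` in the closed disc. For `α > 0` such
functions are automatically continuous on the closed disc. -/
noncomputable def analyticLip (α : ℝ) : Submodule ℂ C(ClosedDisc, ℂ) where
  carrier := {f | AnalyticInDisc f ∧
    ∃ K : ℝ, ∀ z v : ClosedDisc, ‖f z - f v‖ ≤ K * ‖(z : ℂ) - (v : ℂ)‖ ^ α}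
  zero_mem' := ⟨AnalyticInDisc.zero, 0, fun z v => by simp⟩
  add_mem' := by
    rintro f₁ f₂ ⟨h₁, K₁, hK₁⟩ ⟨h₂, K₂, hK₂⟩
    refine ⟨h₁.add h₂, K₁ + K₂, fun z v => ?_⟩
    have e : (f₁ + f₂) z - (f₁ + f₂) v = (f₁ z - f₁ v) + (f₂ z - f₂ v) := by
      simp only [ContinuousMap.add_apply]; ring
    rw [e, add_mul]
    exact (norm_add_le _ _).trans (add_le_add (hK₁ z v) (hK₂ z v))
  smul_mem' := by
    rintro c f ⟨h, K, hK⟩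
    refine ⟨h.const_mul c, ‖c‖ * K, fun z v => ?_⟩
    have e : (c • f) z - (c • f) v = c * (f z - f v) := by
      simp only [ContinuousMap.smul_apply, smul_eq_mul]; ring
    rw [e, norm_mul, mul_assoc]
    exact mul_le_mul_of_nonneg_left (hK z v) (norm_nonneg c)

/-- A self-map of the closed disc, regarded as a complex-valued function. -/
noncomputable def selfMapToComplex (φ : C(ClosedDisc, ClosedDisc)) : C(ClosedDisc, ℂ) :=
  ⟨fun z => (φ z : ℂ), continuous_subtype_val.comp φ.continuous⟩

/-! If two distinct points x, y satisfy a bound a|g(x)| ≤ b|g(y)| with a > 0 for every g in the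
orbit of f, the bound survives scalar multiples and pointwise limits. Density would extend it to all
of E, against a g with g(x) = 1 and g(y) = 0. So one such pair suffices.

Let f be supercyclic. The weight w never vanishes, and f ≠ 0 at fixed points of φ. Schwarz–Pick and
a limiting argument give a fixed point p of φ whose horodiscs (pseudo-hyperbolic discs if p is
interior) are φ-invariant (`exists_fixedPoint_wolff`, `mapsTo_horodisc`). On a small one, |f| ≥ c >
0. If it contains x with φ(x) ≠ x, then T^n f(x) and T^{n+1} f(x) = w(x) T^n f(φ(x)) carry the same
product of weights, multiplying f(φ^n(x)) and (Tf)(φ^n(x)); hence |w(x)| c |T^n f(φ(x))| ≤ ‖Tf‖ |T^n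
f(x)|. Otherwise φ is the identity, T is multiplication by w, and any two points, ordered by |w|,
form such a pair. -/

/-! ### Schwarz–Pick inequality -/

/-- The identity behind the pseudo-hyperbolic distance. -/
theorem Complex.sq_norm_one_sub_conj_mul (a b : ℂ) :
    ‖1 - (starRingEnd ℂ) a * b‖ ^ 2 = ‖a - b‖ ^ 2 + (1 - ‖a‖ ^ 2) * (1 - ‖b‖ ^ 2) := by
  simp only [Complex.sq_norm, Complex.normSq_apply, Complex.sub_re, Complex.sub_im, Complex.mul_re,
    Complex.mul_im, Complex.conj_re, Complex.conj_im, Complex.one_re, Complex.one_im]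
  ring

theorem Complex.one_sub_conj_mul_ne_zero {a b : ℂ} (ha : ‖a‖ < 1) (hb : ‖b‖ < 1) :
    1 - (starRingEnd ℂ) a * b ≠ 0 := by
  intro h
  have h1 := Complex.sq_norm_one_sub_conj_mul a b
  rw [h, norm_zero] at h1
  nlinarith [sq_nonneg ‖a - b‖, norm_nonneg a, norm_nonneg b,
    mul_pos (show 0 < 1 - ‖a‖ ^ 2 by nlinarith [norm_nonneg a])
      (show 0 < 1 - ‖b‖ ^ 2 by nlinarith [norm_nonneg b])]

theorem Complex.norm_sub_le_norm_one_sub_conj_mul {a b : ℂ} (ha : ‖a‖ ≤ 1) (hb : ‖b‖ ≤ 1) :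
    ‖a - b‖ ≤ ‖1 - (starRingEnd ℂ) a * b‖ := by
  refine le_of_sq_le_sq ?_ (norm_nonneg _)
  rw [Complex.sq_norm_one_sub_conj_mul]
  have : 0 ≤ (1 - ‖a‖ ^ 2) * (1 - ‖b‖ ^ 2) :=
    mul_nonneg (by nlinarith [norm_nonneg a]) (by nlinarith [norm_nonneg b])
  linarith

/-- The disc automorphism moving `a` to `0`. -/
noncomputable def discMoebius (a z : ℂ) : ℂ := (z - a) / (1 - (starRingEnd ℂ) a * z)

theorem norm_discMoebius_le {a z : ℂ} (ha : ‖a‖ ≤ 1) (hz : ‖z‖ ≤ 1) : ‖discMoebius a z‖ ≤ 1 := by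
  rw [discMoebius, norm_div, norm_sub_rev]
  exact div_le_one_of_le₀ (Complex.norm_sub_le_norm_one_sub_conj_mul ha hz) (norm_nonneg _)

theorem norm_discMoebius_lt {a z : ℂ} (ha : ‖a‖ < 1) (hz : ‖z‖ < 1) : ‖discMoebius a z‖ < 1 := by
  rw [discMoebius, norm_div, norm_sub_rev,
    div_lt_one (norm_pos_iff.2 (Complex.one_sub_conj_mul_ne_zero ha hz))]
  refine lt_of_pow_lt_pow_left₀ 2 (norm_nonneg _) ?_
  rw [Complex.sq_norm_one_sub_conj_mul]
  have : 0 < (1 - ‖a‖ ^ 2) * (1 - ‖z‖ ^ 2) :=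
    mul_pos (by nlinarith [norm_nonneg a]) (by nlinarith [norm_nonneg z])
  linarith

theorem discMoebius_neg_discMoebius {a z : ℂ} (ha : ‖a‖ < 1) (hz : ‖z‖ < 1) :
    discMoebius (-a) (discMoebius a z) = z := by
  have h1 := Complex.one_sub_conj_mul_ne_zero ha hz
  have h3 : 1 - (starRingEnd ℂ) (-a) * discMoebius a z ≠ 0 :=
    Complex.one_sub_conj_mul_ne_zero (by rwa [norm_neg]) (norm_discMoebius_lt ha hz)
  have hu : discMoebius a z * (1 - (starRingEnd ℂ) a * z) = z - a := div_mul_cancel₀ _ h1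
  rw [discMoebius, div_eq_iff h3, map_neg]
  linear_combination hu

theorem differentiableOn_discMoebius {a : ℂ} (ha : ‖a‖ < 1) :
    DifferentiableOn ℂ (discMoebius a) (Metric.ball 0 1) := by
  unfold discMoebius
  refine DifferentiableOn.div (by fun_prop) (by fun_prop) fun z hz => ?_
  exact Complex.one_sub_conj_mul_ne_zero ha (mem_ball_zero_iff.1 hz)

/-- Schwarz's lemma for g conjugated by automorphisms so that it fixes 0, evaluated at `discMoebius
w z`. -/
theorem norm_discMoebius_map_le {g : ℂ → ℂ} (hg : DifferentiableOn ℂ g (Metric.ball 0 1))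
    (hm : Set.MapsTo g (Metric.ball 0 1) (Metric.ball 0 1)) {z w : ℂ} (hz : ‖z‖ < 1)
    (hw : ‖w‖ < 1) : ‖discMoebius (g w) (g z)‖ ≤ ‖discMoebius w z‖ := by
  have hw' : ‖-w‖ < 1 := by rwa [norm_neg]
  have hgw : ‖g w‖ < 1 := mem_ball_zero_iff.1 (hm (mem_ball_zero_iff.2 hw))
  have hM : Set.MapsTo (discMoebius (-w)) (Metric.ball 0 1) (Metric.ball 0 1) := fun ζ hζ =>
    mem_ball_zero_iff.2 (norm_discMoebius_lt hw' (mem_ball_zero_iff.1 hζ))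
  have hd : DifferentiableOn ℂ (discMoebius (g w) ∘ g ∘ discMoebius (-w)) (Metric.ball 0 1) :=
    (differentiableOn_discMoebius hgw).comp
      (hg.comp (differentiableOn_discMoebius hw') hM) (hm.comp hM)
  have key := Complex.norm_le_norm_of_mapsTo_ball hd (z := discMoebius w z)
    (fun ζ hζ => mem_closedBall_zero_iff.2 (norm_discMoebius_le hgw.le
      (mem_ball_zero_iff.1 (hm (hM hζ))).le)) (by simp [discMoebius]) (norm_discMoebius_lt hw hz)
  simpa [discMoebius_neg_discMoebius hw hz] using key

/-- The Schwarz–Pick inequality for maps of the open disc into itself, cleared of denominators. -/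
theorem schwarzPick_of_mapsTo_ball {g : ℂ → ℂ} (hg : DifferentiableOn ℂ g (Metric.ball 0 1))
    (hm : Set.MapsTo g (Metric.ball 0 1) (Metric.ball 0 1)) {z w : ℂ} (hz : ‖z‖ < 1)
    (hw : ‖w‖ < 1) :
    ‖g z - g w‖ ^ 2 * ((1 - ‖z‖ ^ 2) * (1 - ‖w‖ ^ 2)) ≤
      ‖z - w‖ ^ 2 * ((1 - ‖g z‖ ^ 2) * (1 - ‖g w‖ ^ 2)) := by
  have hgz : ‖g z‖ < 1 := mem_ball_zero_iff.1 (hm (mem_ball_zero_iff.2 hz))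
  have hgw : ‖g w‖ < 1 := mem_ball_zero_iff.1 (hm (mem_ball_zero_iff.2 hw))
  have h := norm_discMoebius_map_le hg hm hz hw
  rw [discMoebius, discMoebius, norm_div, norm_div,
    div_le_div_iff₀ (norm_pos_iff.2 (Complex.one_sub_conj_mul_ne_zero hgw hgz))
      (norm_pos_iff.2 (Complex.one_sub_conj_mul_ne_zero hw hz))] at h
  have h2 := pow_le_pow_left₀ (by positivity) h 2
  rw [mul_pow, mul_pow, Complex.sq_norm_one_sub_conj_mul, Complex.sq_norm_one_sub_conj_mul,
    norm_sub_rev (g w), norm_sub_rev w] at h2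
  nlinarith [h2]

/-- The Schwarz–Pick inequality for maps of the open disc into the closed disc. -/
theorem schwarzPick {g : ℂ → ℂ} (hg : DifferentiableOn ℂ g (Metric.ball 0 1))
    (hm : Set.MapsTo g (Metric.ball 0 1) (Metric.closedBall 0 1)) {z w : ℂ} (hz : ‖z‖ < 1)
    (hw : ‖w‖ < 1) :
    ‖g z - g w‖ ^ 2 * ((1 - ‖z‖ ^ 2) * (1 - ‖w‖ ^ 2)) ≤
      ‖z - w‖ ^ 2 * ((1 - ‖g z‖ ^ 2) * (1 - ‖g w‖ ^ 2)) := by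
  -- Shrinking by s < 1 puts the image in the open disc; then s → 1.
  have hs : ∀ s ∈ Set.Ioo (0 : ℝ) 1,
      ‖s * g z - s * g w‖ ^ 2 * ((1 - ‖z‖ ^ 2) * (1 - ‖w‖ ^ 2)) ≤
      ‖z - w‖ ^ 2 * ((1 - ‖s * g z‖ ^ 2) * (1 - ‖s * g w‖ ^ 2)) := by
    rintro s ⟨hs0, hs1⟩
    refine schwarzPick_of_mapsTo_ball (g := fun z => s * g z) (hg.const_mul _) (fun ζ hζ => ?_) hz hw
    have h1 : ‖g ζ‖ ≤ 1 := mem_closedBall_zero_iff.1 (hm hζ)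
    rw [mem_ball_zero_iff, norm_mul, Complex.norm_real, Real.norm_of_nonneg hs0.le]
    nlinarith [norm_nonneg (g ζ)]
  have hcl : (1 : ℝ) ∈ closure (Set.Ioo (0 : ℝ) 1) := by
    rw [closure_Ioo (by norm_num)]; simp
  have := le_on_closure (f := fun s : ℝ =>
      ‖s * g z - s * g w‖ ^ 2 * ((1 - ‖z‖ ^ 2) * (1 - ‖w‖ ^ 2)))
    (g := fun s : ℝ => ‖z - w‖ ^ 2 * ((1 - ‖s * g z‖ ^ 2) * (1 - ‖s * g w‖ ^ 2)))
    hs (by fun_prop) (by fun_prop) hcl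
  simpa using this

/-! ### Fixed points and Wolff's inequality -/

/-- A contraction of the disc of the form `r • g` with `r < 1` has a fixed point. -/
theorem exists_mul_eq_self {g : ℂ → ℂ} (hg : DifferentiableOn ℂ g (Metric.ball 0 1))
    (hm : Set.MapsTo g (Metric.ball 0 1) (Metric.closedBall 0 1)) {r : ℝ} (hr0 : 0 ≤ r)
    (hr1 : r < 1) : ∃ z : ℂ, ‖z‖ < 1 ∧ r * g z = z := by
  have hsub : Metric.closedBall (0 : ℂ) r ⊆ Metric.ball 0 1 := Metric.closedBall_subset_ball hr1
  set ψ : ℂ → ℂ := fun z => r * g z with hψ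
  have hψm : Set.MapsTo ψ (Metric.ball 0 1) (Metric.closedBall 0 r) := fun z hz => by
    have h1 : ‖g z‖ ≤ 1 := mem_closedBall_zero_iff.1 (hm hz)
    rw [mem_closedBall_zero_iff, norm_mul, Complex.norm_real, Real.norm_of_nonneg hr0]
    nlinarith
  have hpos : ∀ z ∈ Metric.closedBall (0 : ℂ) r, 0 < 1 - ‖z‖ ^ 2 := fun z hz => by
    have h1 : ‖z‖ ≤ r := mem_closedBall_zero_iff.1 hz
    nlinarith [norm_nonneg z]
  have hψc : ContinuousOn ψ (Metric.closedBall 0 r) :=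
    (continuousOn_const.mul hg.continuousOn).mono hsub
  -- This quotient is ρ²/(1 - ρ²), with ρ the pseudo-hyperbolic distance from z to ψ(z). At a
  -- minimiser, Schwarz–Pick with the extra factor r² < 1 forces ρ = 0.
  have hFc : ContinuousOn (fun z => ‖z - ψ z‖ ^ 2 / ((1 - ‖z‖ ^ 2) * (1 - ‖ψ z‖ ^ 2)))
      (Metric.closedBall 0 r) :=
    ContinuousOn.div (by fun_prop) (by fun_prop) fun z hz =>
      (mul_pos (hpos z hz) (hpos _ (hψm (hsub hz)))).ne'
  obtain ⟨z, hz, hmin⟩ := (isCompact_closedBall (0 : ℂ) r).exists_isMinOn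
    ⟨0, Metric.mem_closedBall_self hr0⟩ hFc
  have hw : ψ z ∈ Metric.closedBall (0 : ℂ) r := hψm (hsub hz)
  have hw2 : ψ (ψ z) ∈ Metric.closedBall (0 : ℂ) r := hψm (hsub hw)
  refine ⟨z, mem_ball_zero_iff.1 (hsub hz), ?_⟩
  have hle := hmin hw
  simp only [Set.mem_ofPred_eq] at hle
  rw [div_le_div_iff₀ (mul_pos (hpos _ hz) (hpos _ hw)) (mul_pos (hpos _ hw) (hpos _ hw2))] at hle
  have hsp := schwarzPick hg hm (mem_ball_zero_iff.1 (hsub hz)) (mem_ball_zero_iff.1 (hsub hw))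
  have hn : ‖ψ z - ψ (ψ z)‖ ^ 2 = r ^ 2 * ‖g z - g (ψ z)‖ ^ 2 := by
    rw [show ψ z - ψ (ψ z) = r * (g z - g (ψ z)) by simp only [hψ]; ring, norm_mul,
      Complex.norm_real, mul_pow, Real.norm_of_nonneg hr0]
  have hψg : ∀ x, 1 - ‖g x‖ ^ 2 ≤ 1 - ‖ψ x‖ ^ 2 := fun x => by
    simp only [hψ, norm_mul, Complex.norm_real, Real.norm_of_nonneg hr0]
    have : r ^ 2 ≤ 1 := by nlinarith
    nlinarith [sq_nonneg ‖g x‖]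
  have hg1 : 0 ≤ 1 - ‖g (ψ z)‖ ^ 2 := by
    have := mem_closedBall_zero_iff.1 (hm (hsub hw))
    nlinarith [norm_nonneg (g (ψ z))]
  have hprod : (1 - ‖g z‖ ^ 2) * (1 - ‖g (ψ z)‖ ^ 2) ≤ (1 - ‖ψ z‖ ^ 2) * (1 - ‖ψ (ψ z)‖ ^ 2) :=
    mul_le_mul (hψg z) (hψg _) hg1 (hpos _ hw).le
  have hP : 0 < (1 - ‖ψ z‖ ^ 2) * (1 - ‖ψ (ψ z)‖ ^ 2) := mul_pos (hpos _ hw) (hpos _ hw2)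
  have h3 : ‖z - ψ z‖ ^ 2 * ((1 - ‖ψ z‖ ^ 2) * (1 - ‖ψ (ψ z)‖ ^ 2)) ≤
      r ^ 2 * (‖z - ψ z‖ ^ 2 * ((1 - ‖ψ z‖ ^ 2) * (1 - ‖ψ (ψ z)‖ ^ 2))) := by
    refine hle.trans ?_
    rw [hn, mul_assoc]
    exact mul_le_mul_of_nonneg_left
      (hsp.trans (mul_le_mul_of_nonneg_left hprod (sq_nonneg _))) (sq_nonneg _)
  have h4 : ‖z - ψ z‖ ^ 2 ≤ 0 := by
    by_contra hcon
    have h5 := mul_pos (not_le.1 hcon) hP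
    have : r ^ 2 < 1 := by nlinarith
    nlinarith
  have h5 : ‖z - ψ z‖ = 0 := by
    have := le_antisymm h4 (sq_nonneg _)
    exact pow_eq_zero_iff two_ne_zero |>.1 this
  exact (sub_eq_zero.1 (norm_eq_zero.1 h5)).symm

theorem ClosedDisc.norm_le_one (z : ClosedDisc) : ‖(z : ℂ)‖ ≤ 1 := mem_closedBall_zero_iff.1 z.2

/-- An analytic self-map of the closed disc has a fixed point `p` at which the inequality of
Schwarz–Pick (`p` in the disc) or of Wolff (`p` on the circle) holds. -/
theorem exists_fixedPoint_wolff (φ : C(ClosedDisc, ClosedDisc))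
    (hφ : AnalyticInDisc fun z => (φ z : ℂ)) :
    ∃ p : ClosedDisc, φ p = p ∧ ∀ z : ClosedDisc, ‖(z : ℂ)‖ < 1 →
      ‖(φ z : ℂ) - p‖ ^ 2 * (1 - ‖(z : ℂ)‖ ^ 2) ≤ ‖(z : ℂ) - p‖ ^ 2 * (1 - ‖(φ z : ℂ)‖ ^ 2) := by
  obtain ⟨g, hg, hgφ⟩ := hφ
  replace hgφ : ∀ z : ClosedDisc, (z : ℂ) ∈ Metric.ball (0 : ℂ) 1 → (φ z : ℂ) = g z := hgφ
  have hm : Set.MapsTo g (Metric.ball 0 1) (Metric.closedBall 0 1) := fun z hz => by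
    have := hgφ ⟨z, Metric.ball_subset_closedBall hz⟩ hz
    rw [← this]
    exact (φ _).2
  have hr0 : ∀ n : ℕ, (0 : ℝ) ≤ n / (n + 1) := fun n => by positivity
  have hr1 : ∀ n : ℕ, (n : ℝ) / (n + 1) < 1 := fun n => by
    rw [div_lt_one (by positivity)]; linarith
  have hex : ∀ n : ℕ, ∃ z : ClosedDisc, ‖(z : ℂ)‖ < 1 ∧ ((n / (n + 1) : ℝ) : ℂ) * φ z = z := by
    intro n
    obtain ⟨z, hz, hfix⟩ := exists_mul_eq_self hg hm (hr0 n) (hr1 n)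
    refine ⟨⟨z, mem_closedBall_zero_iff.2 hz.le⟩, hz, ?_⟩
    rwa [hgφ ⟨z, _⟩ (mem_ball_zero_iff.2 hz)]
  choose z hz hfix using hex
  obtain ⟨p, k, hk, hp⟩ := CompactSpace.tendsto_subseq z
  have hr : Filter.Tendsto (fun n => ((k n : ℝ) / (k n + 1))) Filter.atTop (𝓝 1) :=
    (tendsto_natCast_div_add_atTop (1 : ℝ)).comp hk.tendsto_atTop
  have hrc : Filter.Tendsto (fun n => (((k n : ℝ) / (k n + 1) : ℝ) : ℂ)) Filter.atTop (𝓝 1) := by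
    rw [← Complex.ofReal_one]
    exact (Complex.continuous_ofReal.tendsto 1).comp hr
  have hpc : Filter.Tendsto (fun n => ((z (k n) : ClosedDisc) : ℂ)) Filter.atTop (𝓝 p) :=
    (continuous_subtype_val.tendsto p).comp hp
  have hφp : Filter.Tendsto (fun n => (φ (z (k n)) : ℂ)) Filter.atTop (𝓝 (φ p)) :=
    ((continuous_subtype_val.comp φ.continuous).tendsto p).comp hp
  refine ⟨p, ?_, fun x hx => ?_⟩
  · refine Subtype.ext (tendsto_nhds_unique ?_ hpc)
    have := hrc.mul hφp
    rw [one_mul] at this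
    exact this.congr fun n => hfix (k n)
  · have hrx : Filter.Tendsto (fun n => (((k n : ℝ) / (k n + 1) : ℝ) : ℂ) * (φ x : ℂ))
        Filter.atTop (𝓝 (φ x)) := by
      simpa using hrc.mul_const (φ x : ℂ)
    -- Schwarz–Pick for r • g at x and at its fixed point. The common factor 1 - |z (k n)|² is
    -- cancelled before the limit, since it tends to 0 when p lies on the circle.
    refine le_of_tendsto_of_tendsto' (((hrx.sub hpc).norm.pow 2).mul_const _)
      (((tendsto_const_nhds.sub hpc).norm.pow 2).mul ((hrx.norm.pow 2).const_sub 1)) fun n => ?_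
    set r : ℝ := (k n : ℝ) / (k n + 1) with hrdef
    have hm' : Set.MapsTo (fun z => (r : ℂ) * g z) (Metric.ball 0 1) (Metric.closedBall 0 1) :=
      fun ζ hζ => by
        have h1 : ‖g ζ‖ ≤ 1 := mem_closedBall_zero_iff.1 (hm hζ)
        rw [mem_closedBall_zero_iff, norm_mul, Complex.norm_real, Real.norm_of_nonneg (hr0 _)]
        exact mul_le_one₀ (hr1 _).le (norm_nonneg _) h1
    have h := schwarzPick (hg.const_mul (r : ℂ)) hm' hx (hz (k n))
    rw [← hgφ x (mem_ball_zero_iff.2 hx), ← hgφ _ (mem_ball_zero_iff.2 (hz (k n))), hfix (k n),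
      ← mul_assoc, ← mul_assoc] at h
    refine le_of_mul_le_mul_right h ?_
    have := hz (k n)
    nlinarith [norm_nonneg (z (k n) : ℂ)]

/-! ### Invariant horodiscs -/

/-- The closed horodisc (or pseudo-hyperbolic disc) at `p` of size `t`. -/
def horodisc (p : ClosedDisc) (t : ℝ) : Set ClosedDisc :=
  {z | ‖(z : ℂ) - p‖ ^ 2 ≤ t * (1 - ‖(z : ℂ)‖ ^ 2)}

/-- Inside the disc this is Wolff's inequality; a point of the horodisc on the unit circle must be p
itself, which is fixed. -/
theorem mapsTo_horodisc {φ : C(ClosedDisc, ClosedDisc)} {p : ClosedDisc} (hp : φ p = p)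
    (hw : ∀ z : ClosedDisc, ‖(z : ℂ)‖ < 1 →
      ‖(φ z : ℂ) - p‖ ^ 2 * (1 - ‖(z : ℂ)‖ ^ 2) ≤ ‖(z : ℂ) - p‖ ^ 2 * (1 - ‖(φ z : ℂ)‖ ^ 2))
    (t : ℝ) : Set.MapsTo φ (horodisc p t) (horodisc p t) := by
  intro z hz
  rcases (ClosedDisc.norm_le_one z).lt_or_eq with h | h
  · have hpos : 0 < 1 - ‖(z : ℂ)‖ ^ 2 := by nlinarith [norm_nonneg (z : ℂ)]
    have h1 : 0 ≤ 1 - ‖(φ z : ℂ)‖ ^ 2 := by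
      nlinarith [norm_nonneg (φ z : ℂ), ClosedDisc.norm_le_one (φ z)]
    refine le_of_mul_le_mul_right ((hw z h).trans ?_) hpos
    have := mul_le_mul_of_nonneg_right (show _ ≤ _ from hz) h1
    linarith
  · have hzp : z = p := by
      have h0 : ‖(z : ℂ) - p‖ ^ 2 ≤ 0 := by
        have : ‖(z : ℂ) - p‖ ^ 2 ≤ t * (1 - ‖(z : ℂ)‖ ^ 2) := hz
        rwa [h, one_pow, sub_self, mul_zero] at this
      have h2 := pow_eq_zero_iff two_ne_zero |>.1 (le_antisymm h0 (sq_nonneg _))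
      exact Subtype.ext (sub_eq_zero.1 (norm_eq_zero.1 h2))
    rw [hzp, hp]
    rwa [hzp] at hz

theorem norm_sub_le_of_mem_horodisc {p z : ClosedDisc} {s : ℝ} (hs : 0 ≤ s)
    (hz : z ∈ horodisc p (s ^ 2)) : ‖(z : ℂ) - p‖ ≤ s := by
  refine le_of_sq_le_sq ((show _ ≤ _ from hz).trans ?_) hs
  nlinarith [sq_nonneg ‖(z : ℂ)‖, sq_nonneg s, mul_nonneg (sq_nonneg s) (sq_nonneg ‖(z : ℂ)‖)]

/-- An analytic self-map of the closed disc that is the identity on a horodisc is the identity. -/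
theorem eq_of_fixes_horodisc (φ : C(ClosedDisc, ClosedDisc))
    (hφ : AnalyticInDisc fun z => (φ z : ℂ)) (p : ClosedDisc) {t : ℝ} (ht : 0 < t)
    (hfix : ∀ z ∈ horodisc p t, φ z = z) (z : ClosedDisc) : φ z = z := by
  obtain ⟨g, hg, hgφ⟩ := hφ
  replace hgφ : ∀ z : ClosedDisc, (z : ℂ) ∈ Metric.ball (0 : ℂ) 1 → (φ z : ℂ) = g z := hgφ
  -- The condition on s puts s • p in the interior of the horodisc, as (1 - s)² < t(1 - s²) and |p|
  -- ≤ 1.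
  obtain ⟨s, hs0, hs1, hst⟩ : ∃ s : ℝ, 0 ≤ s ∧ s < 1 ∧ 1 - s < t * (1 + s) := by
    rcases le_or_gt t 1 with h | h
    · exact ⟨1 - t / 2, by linarith, by linarith, by nlinarith⟩
    · exact ⟨0, le_rfl, one_pos, by linarith⟩
  have hp1 := ClosedDisc.norm_le_one p
  have hx : ‖(s : ℂ) * p‖ < 1 := by
    rw [norm_mul, Complex.norm_real, Real.norm_of_nonneg hs0]
    nlinarith [norm_nonneg (p : ℂ)]
  have hU : IsOpen {x : ℂ | ‖x - p‖ ^ 2 < t * (1 - ‖x‖ ^ 2)} :=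
    isOpen_lt (by fun_prop) (by fun_prop)
  have hxU : (s : ℂ) * p ∈ {x : ℂ | ‖x - p‖ ^ 2 < t * (1 - ‖x‖ ^ 2)} := by
    have e : (s : ℂ) * p - p = ((s - 1 : ℝ) : ℂ) * p := by push_cast; ring
    have hpp : ‖(p : ℂ)‖ ^ 2 ≤ 1 := pow_le_one₀ (norm_nonneg _) hp1
    show ‖(s : ℂ) * p - p‖ ^ 2 < t * (1 - ‖(s : ℂ) * p‖ ^ 2)
    rw [e, norm_mul, norm_mul, Complex.norm_real, Complex.norm_real, mul_pow, mul_pow,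
      Real.norm_eq_abs, Real.norm_eq_abs, sq_abs, sq_abs]
    have h1 : (s - 1) ^ 2 * ‖(p : ℂ)‖ ^ 2 ≤ (s - 1) ^ 2 :=
      mul_le_of_le_one_right (sq_nonneg _) hpp
    have h2 : s ^ 2 * ‖(p : ℂ)‖ ^ 2 ≤ s ^ 2 := mul_le_of_le_one_right (sq_nonneg _) hpp
    have h3 : (1 - s) * (1 - s) < (1 - s) * (t * (1 + s)) :=
      mul_lt_mul_of_pos_left hst (by linarith)
    nlinarith [mul_le_mul_of_nonneg_left h2 ht.le]
  have heq : Set.EqOn g id (Metric.ball 0 1) := by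
    refine AnalyticOnNhd.eqOn_of_preconnected_of_eventuallyEq
      (hg.analyticOnNhd Metric.isOpen_ball) analyticOnNhd_id
      (convex_ball 0 1).isPreconnected (mem_ball_zero_iff.2 hx) ?_
    filter_upwards [hU.mem_nhds hxU, Metric.isOpen_ball.mem_nhds (mem_ball_zero_iff.2 hx)]
      with y hy hy1
    have h1 := hfix ⟨y, Metric.ball_subset_closedBall hy1⟩ (le_of_lt hy)
    rw [← hgφ ⟨y, Metric.ball_subset_closedBall hy1⟩ hy1, h1, id]
  have hball : ∀ y ∈ Metric.ball (0 : ℂ) 1, ∀ hy, φ ⟨y, hy⟩ = ⟨y, hy⟩ := fun y hy hy' =>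
    Subtype.ext ((hgφ ⟨y, hy'⟩ hy).trans (heq hy))
  -- Radial path to z, which carries the identity to the circle by continuity; the projection onto
  -- [0, 1] makes it defined on all of ℝ.
  set r : ℝ → ClosedDisc := fun s => ⟨(Set.projIcc (0 : ℝ) 1 zero_le_one s : ℝ) * z, by
    have := (Set.projIcc (0 : ℝ) 1 zero_le_one s).2
    rw [mem_closedBall_zero_iff, norm_mul, Complex.norm_real, Real.norm_of_nonneg this.1]
    exact mul_le_one₀ this.2 (norm_nonneg _) (ClosedDisc.norm_le_one z)⟩ with hr
  have hrc : Continuous r := by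
    refine Continuous.subtype_mk ?_ _
    exact (Complex.continuous_ofReal.comp
      (continuous_subtype_val.comp continuous_projIcc)).mul continuous_const
  have hr1 : r 1 = z := by
    apply Subtype.ext
    simp [hr]
  have hcl : (1 : ℝ) ∈ closure (Set.Ico (0 : ℝ) 1) := by
    rw [closure_Ico (by norm_num)]; simp
  have hs : Set.EqOn (fun s => φ (r s)) r (Set.Ico 0 1) := fun s hs => by
    refine hball _ ?_ _
    rw [Set.projIcc_of_mem _ ⟨hs.1, hs.2.le⟩, mem_ball_zero_iff, norm_mul, Complex.norm_real,
      Real.norm_of_nonneg hs.1]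
    nlinarith [ClosedDisc.norm_le_one z, norm_nonneg (z : ℂ), hs.1, hs.2]
  have := hs.closure (φ.continuous.comp hrc) hrc hcl
  simpa only [hr1] using this

/-! ### Obstructions to a dense projective orbit -/

/-- A closed relation between two values that holds along the projective orbit of a supercyclic
vector holds on the whole space. -/
theorem forall_of_dense_orbit {X E : Type*} [TopologicalSpace X] [AddCommGroup E] [Module ℂ E]
    {i : E →ₗ[ℂ] C(X, ℂ)} {T : E →ₗ[ℂ] E} {f : E}
    (hf : @Dense E (TopologicalSpace.induced i (pointwiseTopology X))
      {g : E | ∃ (c : ℂ) (n : ℕ), g = c • (T ^ n) f})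
    {x y : X} {S : Set (ℂ × ℂ)} (hS : IsClosed S)
    (h : ∀ (c : ℂ) (n : ℕ), (c * i ((T ^ n) f) x, c * i ((T ^ n) f) y) ∈ S) (g : E) :
    (i g x, i g y) ∈ S := by
  let τ : TopologicalSpace E := TopologicalSpace.induced i (pointwiseTopology X)
  have hev : ∀ x, Continuous fun g : E => i g x := fun x => by
    let := pointwiseTopology X
    exact (continuous_apply x).comp
      ((continuous_induced_dom (f := fun f : C(X, ℂ) => (f : X → ℂ))).comp
        (continuous_induced_dom (f := i)))
  refine closure_minimal (s := {g : E | ∃ (c : ℂ) (n : ℕ), g = c • (T ^ n) f}) ?_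
    (hS.preimage ((hev x).prodMk (hev y))) (hf g)
  rintro _ ⟨c, n, rfl⟩
  simpa using h c n

instance ClosedDisc.instNontrivial : Nontrivial ClosedDisc :=
  ⟨⟨⟨0, by simp⟩, ⟨1, by simp⟩, fun h => zero_ne_one (congrArg Subtype.val h)⟩⟩

section Core

variable {X E : Type*} [TopologicalSpace X] [AddCommGroup E] [Module ℂ E]
  {i : E →ₗ[ℂ] C(X, ℂ)} {T : E →ₗ[ℂ] E} {f : E} {w : C(X, ℂ)} {φ : C(X, X)}

/-- A dominated value along the orbit contradicts separation of points. -/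
theorem not_dense_orbit_of_le (sep : ∀ x y : X, x ≠ y → ∃ g : E, i g x = 1 ∧ i g y = 0)
    {x y : X} (hxy : x ≠ y) {a b : ℝ} (ha : 0 < a)
    (h : ∀ n : ℕ, a * ‖i ((T ^ n) f) x‖ ≤ b * ‖i ((T ^ n) f) y‖) :
    ¬ @Dense E (TopologicalSpace.induced i (pointwiseTopology X))
      {g : E | ∃ (c : ℂ) (n : ℕ), g = c • (T ^ n) f} := by
  intro hf
  obtain ⟨g, hgx, hgy⟩ := sep x y hxy
  have := forall_of_dense_orbit hf (x := x) (y := y) (S := {q | a * ‖q.1‖ ≤ b * ‖q.2‖})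
    (isClosed_le (by fun_prop) (by fun_prop)) (fun c n => by
      have := mul_le_mul_of_nonneg_left (h n) (norm_nonneg c)
      simp only [Set.mem_ofPred_eq, norm_mul]
      linarith) g
  simp only [Set.mem_ofPred_eq, hgx, hgy, norm_one, norm_zero] at this
  linarith

theorem not_dense_orbit_of_eq_zero (sep : ∀ x y : X, x ≠ y → ∃ g : E, i g x = 1 ∧ i g y = 0)
    {x y : X} (hxy : x ≠ y) (h : ∀ n : ℕ, i ((T ^ n) f) x = 0) :
    ¬ @Dense E (TopologicalSpace.induced i (pointwiseTopology X))
      {g : E | ∃ (c : ℂ) (n : ℕ), g = c • (T ^ n) f} :=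
  not_dense_orbit_of_le sep hxy one_pos (b := 0) fun n => by simp [h n]

/-- If w(x) = 0, every iterate after f itself vanishes at x, so each orbit element either vanishes
at x or is proportional to f. This is a closed relation between the values at x and y; it forces
f(x) = 0, and then the whole orbit vanishes at x. -/
theorem weight_ne_zero (sep : ∀ x y : X, x ≠ y → ∃ g : E, i g x = 1 ∧ i g y = 0)
    (hT : ∀ f : E, i (T f) = weightedComp w φ (i f))
    (hf : @Dense E (TopologicalSpace.induced i (pointwiseTopology X))
      {g : E | ∃ (c : ℂ) (n : ℕ), g = c • (T ^ n) f})
    {x y : X} (hxy : x ≠ y) : w x ≠ 0 := by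
  intro hw
  have hn : ∀ n : ℕ, i ((T ^ (n + 1)) f) x = 0 := fun n => by
    rw [pow_succ', Module.End.mul_apply, hT]
    show w x * _ = 0
    rw [hw, zero_mul]
  have key : ∀ g : E, i g x * (i g y * i f x - i g x * i f y) = 0 :=
    forall_of_dense_orbit hf (x := x) (y := y)
      (S := {q | q.1 * (q.2 * i f x - q.1 * i f y) = 0})
      (isClosed_eq (by fun_prop) (by fun_prop)) (fun c n => by
        simp only [Set.mem_ofPred_eq]
        rcases n with _ | n
        · simp only [pow_zero, Module.End.one_apply]; ring
        · rw [hn]; ring)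
  obtain ⟨g, hgx, hgy⟩ := sep x y hxy
  obtain ⟨k, hky, hkx⟩ := sep y x hxy.symm
  -- The value pairs (1, 0) and (1, 1) at (x, y) give f(y) = 0 and f(x) = f(y).
  have h1 := key g
  have h2 := key (g + k)
  simp only [map_add, ContinuousMap.add_apply, hgx, hgy, hkx, hky] at h1 h2
  have hfx : i f x = 0 := by linear_combination h2 - h1
  exact not_dense_orbit_of_eq_zero sep hxy (fun n => by
    rcases n with _ | n
    · simpa using hfx
    · exact hn n) hf

end Core

theorem weightedComp_pow_apply {X E : Type*} [TopologicalSpace X] [AddCommGroup E] [Module ℂ E]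
    {i : E →ₗ[ℂ] C(X, ℂ)} {T : E →ₗ[ℂ] E} {w : C(X, ℂ)} {φ : C(X, X)}
    (hT : ∀ f : E, i (T f) = weightedComp w φ (i f)) (n : ℕ) (f : E) (x : X) :
    i ((T ^ n) f) x = (∏ j ∈ Finset.range n, w (φ^[j] x)) * i f (φ^[n] x) := by
  induction n generalizing f with
  | zero => simp
  | succ n ih =>
    rw [pow_succ, Module.End.mul_apply, ih, hT, Finset.prod_range_succ,
      Function.iterate_succ_apply', mul_assoc]
    rfl

/-! ### The main argument for analytic symbols -/

/-- A weighted composition operator whose symbol is analytic is not supercyclic for the pointwise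
topology, on any space of functions on the closed disc that separates pairs of points. -/
theorem not_isPointwiseSupercyclic_of_separating {E : Type*} [AddCommGroup E] [Module ℂ E]
    (i : E →ₗ[ℂ] C(ClosedDisc, ℂ))
    (sep : ∀ x y : ClosedDisc, x ≠ y → ∃ g : E, i g x = 1 ∧ i g y = 0)
    (w : C(ClosedDisc, ℂ)) (φ : C(ClosedDisc, ClosedDisc))
    (hφ : AnalyticInDisc fun z => (φ z : ℂ)) (T : E →ₗ[ℂ] E)
    (hT : ∀ f : E, i (T f) = weightedComp w φ (i f)) : ¬ IsPointwiseSupercyclic i T := by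
  rintro ⟨f, hf⟩
  have hother : ∀ x : ClosedDisc, ∃ y, x ≠ y := fun x => (exists_ne x).imp fun _ h => h.symm
  have hw : ∀ x, w x ≠ 0 := fun x => (hother x).elim fun y hy => weight_ne_zero sep hT hf hy
  have hiter := weightedComp_pow_apply hT
  have hfp : ∀ p, φ p = p → i f p ≠ 0 := fun p hp h0 => by
    obtain ⟨y, hy⟩ := hother p
    refine not_dense_orbit_of_eq_zero sep hy (fun n => ?_) hf
    rw [hiter, Function.iterate_fixed hp, h0, mul_zero]
  obtain ⟨p, hp, hwolff⟩ := exists_fixedPoint_wolff φ hφ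
  obtain ⟨c, hc, s, hs, hlow⟩ : ∃ c : ℝ, 0 < c ∧ ∃ s : ℝ, 0 < s ∧
      ∀ z ∈ horodisc p (s ^ 2), c ≤ ‖i f z‖ := by
    have hpos : 0 < ‖i f p‖ := norm_pos_iff.2 (hfp p hp)
    have hev : ∀ᶠ z in 𝓝 p, ‖i f p‖ / 2 < ‖i f z‖ :=
      (i f).continuous.norm.continuousAt.eventually (lt_mem_nhds (by linarith))
    obtain ⟨ε, hε, hball⟩ := Metric.eventually_nhds_iff.1 hev
    refine ⟨‖i f p‖ / 2, by linarith, ε / 2, by linarith, fun z hz => (hball ?_).le⟩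
    rw [Subtype.dist_eq, dist_eq_norm]
    linarith [norm_sub_le_of_mem_horodisc (by linarith) hz]
  by_cases hfix : ∀ z ∈ horodisc p (s ^ 2), φ z = z
  · have hid := eq_of_fixes_horodisc φ hφ p (by positivity) hfix
    obtain ⟨y, hy⟩ := hother p
    have hpow : ∀ (n : ℕ) (x : ClosedDisc), i ((T ^ n) f) x = w x ^ n * i f x := fun n x => by
      simp [hiter, Function.iterate_fixed (hid x)]
    have main : ∀ x y : ClosedDisc, x ≠ y → ‖w x‖ ≤ ‖w y‖ → False := fun x y hxy hle => by
      refine not_dense_orbit_of_le sep hxy (norm_pos_iff.2 (hfp y (hid y))) (b := ‖i f x‖)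
        (fun n => ?_) hf
      rw [hpow, hpow, norm_mul, norm_mul, norm_pow, norm_pow]
      have := mul_le_mul_of_nonneg_right (pow_le_pow_left₀ (norm_nonneg _) hle n)
        (mul_nonneg (norm_nonneg (i f x)) (norm_nonneg (i f y)))
      linarith
    rcases le_total ‖w p‖ ‖w y‖ with h | h
    · exact main p y hy h
    · exact main y p hy.symm h
  · push Not at hfix
    obtain ⟨x, hx, hne⟩ := hfix
    have horb : ∀ n, φ^[n] x ∈ horodisc p (s ^ 2) := fun n =>
      (mapsTo_horodisc hp hwolff (s ^ 2)).iterate n hx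
    refine not_dense_orbit_of_le sep hne (a := ‖w x‖ * c) (b := ‖i (T f)‖)
      (mul_pos (norm_pos_iff.2 (hw x)) hc) (fun n => ?_) hf
    -- Both sides are T^{n+1} f at x, split as T(T^n f) and as T^n(Tf).
    have h1 : w x * i ((T ^ n) f) (φ x) =
        (∏ j ∈ Finset.range n, w (φ^[j] x)) * i (T f) (φ^[n] x) := by
      rw [← hiter n (T f) x, ← Module.End.mul_apply, ← pow_succ, pow_succ', Module.End.mul_apply, hT]
      rfl
    have h2 := congrArg norm h1
    rw [norm_mul, norm_mul] at h2
    rw [mul_right_comm, h2, hiter n f x, norm_mul]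
    have h3 := (i (T f)).norm_coe_le_norm (φ^[n] x)
    have h4 := mul_le_mul h3 (hlow _ (horb n)) hc.le (norm_nonneg _)
    have h5 := mul_le_mul_of_nonneg_left h4 (norm_nonneg (∏ j ∈ Finset.range n, w (φ^[j] x)))
    linarith

/-! ### Separating points; the disc algebra and Lipschitz spaces -/

/-- Otherwise the kernel of δ_y lies in that of δ_x, making δ_x a multiple of δ_y. -/
theorem PointwiseEmbedding.exists_separating {X : Type*} [TopologicalSpace X] {E : Type*}
    [AddCommGroup E] [Module ℂ E] [TopologicalSpace E] [IsTopologicalAddGroup E]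
    [ContinuousSMul ℂ E] (J : PointwiseEmbedding X E) (hJ : LinearIndependent ℂ J.eval) {x y : X}
    (hxy : x ≠ y) : ∃ g : E, J.toLin g x = 1 ∧ J.toLin g y = 0 := by
  by_contra! hcon
  have hker : ∀ g, J.eval y g = 0 → J.eval x g = 0 := fun g hg => by
    by_contra hx
    refine hcon ((J.eval x g)⁻¹ • g) ?_ ?_
    · show J.toLin _ x = 1
      rw [map_smul]
      exact inv_mul_cancel₀ hx
    · show J.toLin _ y = 0
      rw [map_smul]
      exact (congrArg _ hg).trans (mul_zero _)
  have hspan : (J.eval x).toLinearMap ∈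
      Submodule.span ℂ (Set.range fun _ : Unit => (J.eval y).toLinearMap) :=
    mem_span_of_iInf_ker_le_ker fun g hg => hker g (by simpa using hg)
  rw [Set.range_const, Submodule.mem_span_singleton] at hspan
  obtain ⟨a, ha⟩ := hspan
  have hmem : J.eval x ∈ Submodule.span ℂ (J.eval '' {y}) := by
    rw [Set.image_singleton, Submodule.mem_span_singleton]
    exact ⟨a, ContinuousLinearMap.coe_injective ha⟩
  exact hJ.notMem_span_image (s := {y}) (by simpa using hxy) hmem

/-- The coordinate function on the closed disc. -/
noncomputable def discCoord : C(ClosedDisc, ℂ) := ⟨fun z => z, continuous_subtype_val⟩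

theorem AnalyticInDisc.div {f₁ f₂ : ClosedDisc → ℂ} (h₁ : AnalyticInDisc f₁)
    (h₂ : AnalyticInDisc f₂) (h0 : ∀ z, f₂ z ≠ 0) : AnalyticInDisc fun z => f₁ z / f₂ z := by
  obtain ⟨g₁, hg₁, e₁⟩ := h₁
  obtain ⟨g₂, hg₂, e₂⟩ := h₂
  refine ⟨fun z => g₁ z / g₂ z, hg₁.div hg₂ fun z hz => ?_, fun z hz => by
    simp only [e₁ z hz, e₂ z hz]⟩
  rw [← e₂ ⟨z, Metric.ball_subset_closedBall hz⟩ hz]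
  exact h0 _

/-- On a space of analytic functions containing the affine functions, no weighted composition
operator is supercyclic for the pointwise topology. -/
theorem not_isPointwiseSupercyclic_of_affine_mem (E : Submodule ℂ C(ClosedDisc, ℂ))
    (hE : E ≤ discAlgebra) (h1 : (1 : C(ClosedDisc, ℂ)) ∈ E) (hz : discCoord ∈ E)
    (w : C(ClosedDisc, ℂ)) (φ : C(ClosedDisc, ClosedDisc))
    (h : ∀ f ∈ E, weightedComp w φ f ∈ E) :
    ¬ IsPointwiseSupercyclic E.subtype ((weightedComp w φ).restrict h) := by
  have hT : ∀ f : E, E.subtype ((weightedComp w φ).restrict h f) =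
      weightedComp w φ (E.subtype f) := fun _ => rfl
  have sep : ∀ x y : ClosedDisc, x ≠ y → ∃ g : E, E.subtype g x = 1 ∧ E.subtype g y = 0 := by
    intro x y hxy
    have hne : (x : ℂ) - y ≠ 0 := sub_ne_zero.2 fun h => hxy (Subtype.ext h)
    refine ⟨⟨((x : ℂ) - y)⁻¹ • (discCoord - (y : ℂ) • 1),
      E.smul_mem _ (E.sub_mem hz (E.smul_mem _ h1))⟩, ?_, ?_⟩
    · simp [discCoord, inv_mul_cancel₀ hne]
    · simp [discCoord]
  intro hsc
  have hw : ∀ x, w x ≠ 0 := fun x => by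
    obtain ⟨f, hf⟩ := hsc
    obtain ⟨y, hy⟩ := exists_ne x
    exact weight_ne_zero sep hT hf hy.symm
  have hwA : AnalyticInDisc w := by
    have : AnalyticInDisc (weightedComp w φ 1) := hE (h 1 h1)
    have e : weightedComp w φ 1 = w := by ext x; simp [weightedComp]
    rwa [e] at this
  -- Analyticity of φ comes from φ = C(z)/C(1), where C is the operator and C(1) = w has no zeros.
  have hφ : AnalyticInDisc fun z => (φ z : ℂ) := by
    have h2 : AnalyticInDisc (weightedComp w φ discCoord) := hE (h _ hz)
    have h3 := h2.div hwA hw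
    have e : (fun z => weightedComp w φ discCoord z / w z) = fun z => (φ z : ℂ) := by
      ext x
      exact mul_div_cancel_left₀ _ (hw x)
    rwa [e] at h3
  exact not_isPointwiseSupercyclic_of_separating E.subtype sep w φ hφ _ hT hsc

theorem one_mem_discAlgebra : (1 : C(ClosedDisc, ℂ)) ∈ discAlgebra :=
  ⟨fun _ => 1, differentiableOn_const 1, fun _ _ => rfl⟩

theorem discCoord_mem_discAlgebra : discCoord ∈ discAlgebra :=
  ⟨fun z => z, differentiableOn_id, fun _ _ => rfl⟩

theorem one_mem_analyticLip (α : ℝ) : (1 : C(ClosedDisc, ℂ)) ∈ analyticLip α :=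
  ⟨one_mem_discAlgebra, 0, fun z v => by simp⟩

theorem discCoord_mem_analyticLip {α : ℝ} (h0 : 0 < α) (h1 : α ≤ 1) :
    discCoord ∈ analyticLip α := by
  -- The constant 2 is the diameter of the disc, needed when |z - v| ≥ 1.
  refine ⟨discCoord_mem_discAlgebra, 2, fun z v => ?_⟩
  show ‖(z : ℂ) - v‖ ≤ 2 * ‖(z : ℂ) - v‖ ^ α
  have h2 : ‖(z : ℂ) - v‖ ≤ 2 :=
    (norm_sub_le _ _).trans (by linarith [z.norm_le_one, v.norm_le_one])
  rcases le_total ‖(z : ℂ) - v‖ 1 with h | h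
  · have := Real.rpow_le_rpow_of_exponent_ge' (norm_nonneg _) h h0.le h1
    rw [Real.rpow_one] at this
    linarith [norm_nonneg ((z : ℂ) - v)]
  · have := Real.one_le_rpow h h0.le
    linarith

theorem theorem2p9 :
    -- general spaces `E`, continuously included in `C(ClosedDisc)` with the pointwise topology
    (∀ (E : Type u) [AddCommGroup E] [Module ℂ E] [TopologicalSpace E] [IsTopologicalAddGroup E]
        [ContinuousSMul ℂ E] [LocallyConvexSpace ℝ E] (J : PointwiseEmbedding ClosedDisc E),
      LinearIndependent ℂ J.eval →
      ∀ (w : C(ClosedDisc, ℂ)) (φ : C(ClosedDisc, ClosedDisc)),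
        selfMapToComplex φ ∈ discAlgebra →
        ∀ T : E →ₗ[ℂ] E, (∀ f : E, J.toLin (T f) = weightedComp w φ (J.toLin f)) →
          ¬ IsPointwiseSupercyclic J.toLin T) ∧
    -- the disc algebra
    (∀ (w : C(ClosedDisc, ℂ)) (φ : C(ClosedDisc, ClosedDisc))
        (h : ∀ f ∈ discAlgebra, weightedComp w φ f ∈ discAlgebra),
      ¬ IsPointwiseSupercyclic discAlgebra.subtype ((weightedComp w φ).restrict h)) ∧
    -- the analytic Lipschitz spaces
    (∀ α : ℝ, 0 < α → α ≤ 1 →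
      ∀ (w : C(ClosedDisc, ℂ)) (φ : C(ClosedDisc, ClosedDisc))
        (h : ∀ f ∈ analyticLip α, weightedComp w φ f ∈ analyticLip α),
      ¬ IsPointwiseSupercyclic (analyticLip α).subtype ((weightedComp w φ).restrict h)) := by
  refine ⟨?_, fun w φ h => ?_, fun α h0 h1 w φ h => ?_⟩
  · intro E _ _ _ _ _ _ J hJ w φ hφ T hT
    exact not_isPointwiseSupercyclic_of_separating J.toLin
      (fun x y hxy => J.exists_separating hJ hxy) w φ hφ T hT
  · exact not_isPointwiseSupercyclic_of_affine_mem discAlgebra le_rfl one_mem_discAlgebra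
      discCoord_mem_discAlgebra w φ h
  · exact not_isPointwiseSupercyclic_of_affine_mem (analyticLip α) (fun f hf => hf.1)
      (one_mem_analyticLip α) (discCoord_mem_analyticLip h0 h1) w φ h
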